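/- Let $A = 1123187040185717205972$ and $B = 50786893859117937639786031372848$. The equation $E : y^2 = x^3 + Ax + B$ defines an elliptic curve over $\mathbb{Q}$, and the Mordell–Weil group $E(\mathbb{Q})$ has rank at least $6$. More precisely, the six pairs $$(67585071288,\ 20866449849961716),\quad (60673071396,\ 18500949214922664),\quad (49153071576,\ 14991664661755236),$$ $$(33025071828,\ 11131001682078096),\quad (12289072152,\ 8151425152633980),\quad (-13054927452,\ 5822267813027064)$$ are points of $E(\mathbb{Q})$, and they are linearly independent over $\mathbb{Z}$ in $E(\mathbb{Q})$. -/

import Mathlib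

/-- The Weierstrass curve `y² = x³ + 1123187040185717205972 x + 50786893859117937639786031372848`
over `ℚ`. -/
def rankSixCurve : WeierstrassCurve.Affine ℚ where
  a₁ := 0
  a₂ := 0
  a₃ := 0
  a₄ := 1123187040185717205972
  a₆ := 50786893859117937639786031372848

/-- The `x`-coordinates of the six explicit points. -/
def pointX : Fin 6 → ℚ :=
  ![67585071288, 60673071396, 49153071576, 33025071828, 12289072152, -13054927452]

/-- The `y`-coordinates of the six explicit points. -/
def pointY : Fin 6 → ℚ :=
  ![20866449849961716, 18500949214922664, 14991664661755236, 11131001682078096,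
    8151425152633980, 5822267813027064]

/-! The proof is a 2-descent. For a root θ of the cubic in a field K, x - θ is a homomorphism from
the points to the square classes of K (`descentHom`). Take K = ℚ_p and θ the lift of a simple root
modulo p: if all x(Pᵢ) - θ are units, their residue symbols turn a relation among the Pᵢ into a
parity condition on its coefficients (`prod_legendreSym_zpow_eq_one`). Six primes force every
coefficient to be even; the cubic has no rational root, so there is no 2-torsion and a relation can
be halved forever (`linearIndependent_int_of_forall_even`).

The given points themselves escape this test: P₀ + P₁ - P₂ + P₃ - P₄ - P₅ = 2Q is invisible to every
such symbol. The descent therefore runs on Q, P₁, …, P₅, and `sum_points_eq` carries independence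
back. -/

open WeierstrassCurve Polynomial

/-! ### The 2-descent map at a root of the cubic -/

section Descent

variable {F K : Type*} [Field F] [Field K] [Algebra F K]

/-- The function `x - θ` on the points of a Weierstrass curve, with value `1` at infinity. -/
def descentValue (W : WeierstrassCurve.Affine F) (θ : K) : W.Point → K
  | .zero => 1
  | .some x _ _ => algebraMap F K x - θ

lemma descentValue_ne_zero {W : WeierstrassCurve.Affine F} {θ : K}
    (hθ : ∀ x : F, algebraMap F K x ≠ θ) (P : W.Point) : descentValue W θ P ≠ 0 := by
  cases P with
  | zero => exact one_ne_zero
  | some x y h => exact sub_ne_zero.mpr (hθ x)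

variable [DecidableEq F]

/-- At a root `θ` of the cubic, `x - θ` is multiplicative up to squares: restrict the cubic to the
line through the two points. -/
lemma isSquare_descentValue_add {W : WeierstrassCurve.Affine F} (h₁ : W.a₁ = 0) (h₃ : W.a₃ = 0)
    {θ : K} (hroot : θ ^ 3 + algebraMap F K W.a₂ * θ ^ 2 + algebraMap F K W.a₄ * θ +
      algebraMap F K W.a₆ = 0) (P Q : W.Point) :
    IsSquare (descentValue W θ (P + Q) * (descentValue W θ P * descentValue W θ Q)) := by
  rcases P with _ | ⟨x₁, y₁, n₁⟩
  · rw [← Affine.Point.zero_def, zero_add]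
    exact ⟨descentValue W θ Q, by simp [descentValue]⟩
  rcases Q with _ | ⟨x₂, y₂, n₂⟩
  · rw [← Affine.Point.zero_def, add_zero]
    exact ⟨algebraMap F K x₁ - θ, by simp [descentValue]⟩
  by_cases hxy : x₁ = x₂ ∧ y₁ = W.negY x₂ y₂
  · rw [Affine.Point.add_of_Y_eq hxy.1 hxy.2]
    exact ⟨algebraMap F K x₁ - θ, by simp [descentValue, hxy.1]⟩
  · rw [Affine.Point.add_some hxy]
    have key := congrArg (aeval θ) (Affine.addPolynomial_slope n₁.left n₂.left hxy)
    rw [Affine.addPolynomial_eq, Cubic.toPoly, h₁, h₃] at key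
    simp only [map_neg, map_mul, map_sub, map_add, map_pow, aeval_C, aeval_X, map_one, map_zero,
      map_ofNat] at key
    -- The square root is the value at θ of the line through the two points.
    refine ⟨algebraMap F K (W.slope x₁ x₂ y₁ y₂) * (θ - algebraMap F K x₁) +
      algebraMap F K y₁, ?_⟩
    simp only [descentValue]
    linear_combination -key - hroot

/-- The `2`-descent homomorphism `P ↦ x(P) - θ` into the square classes of `K`. -/
noncomputable def descentHom (W : WeierstrassCurve.Affine F) (h₁ : W.a₁ = 0) (h₃ : W.a₃ = 0)
    {θ : K} (hroot : θ ^ 3 + algebraMap F K W.a₂ * θ ^ 2 + algebraMap F K W.a₄ * θ +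
      algebraMap F K W.a₆ = 0) (hθ : ∀ x : F, algebraMap F K x ≠ θ) :
    W.Point →+ Additive (Kˣ ⧸ (powMonoidHom 2 : Kˣ →* Kˣ).range) where
  toFun P := Additive.ofMul
    (QuotientGroup.mk (Units.mk0 (descentValue W θ P) (descentValue_ne_zero hθ P)))
  map_zero' := by
    have h : Units.mk0 (descentValue W θ 0) (descentValue_ne_zero hθ 0) = 1 := Units.ext rfl
    rw [h]
    rfl
  map_add' P Q := by
    rw [← ofMul_mul, ← QuotientGroup.mk_mul]
    refine congrArg Additive.ofMul (QuotientGroup.eq.mpr ?_)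
    obtain ⟨r, hr⟩ := isSquare_descentValue_add h₁ h₃ hroot P Q
    have hne := descentValue_ne_zero hθ (P + Q)
    have hr0 : r ≠ 0 := by
      rintro rfl
      exact mul_ne_zero hne (mul_ne_zero (descentValue_ne_zero hθ P) (descentValue_ne_zero hθ Q))
        (by simpa using hr)
    refine ⟨Units.mk0 (r / descentValue W θ (P + Q)) (div_ne_zero hr0 hne), ?_⟩
    ext
    simp only [powMonoidHom_apply, Units.val_pow_eq_pow_val, Units.val_mk0, Units.val_mul,
      Units.val_inv_eq_inv_val]
    field_simp
    linear_combination -hr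

/-- A relation between points gives a square in `K`. -/
lemma exists_sq_eq_prod_of_sum_zsmul_eq_zero {ι : Type*} [Fintype ι]
    {W : WeierstrassCurve.Affine F} (h₁ : W.a₁ = 0) (h₃ : W.a₃ = 0)
    {θ : K} (hroot : θ ^ 3 + algebraMap F K W.a₂ * θ ^ 2 + algebraMap F K W.a₄ * θ +
      algebraMap F K W.a₆ = 0) (hθ : ∀ x : F, algebraMap F K x ≠ θ)
    (P : ι → W.Point) (n : ι → ℤ) (hn : ∑ i, n i • P i = 0) (u : ι → Kˣ)
    (hu : ∀ i, (u i : K) = descentValue W θ (P i)) : ∃ v : Kˣ, v ^ 2 = ∏ i, u i ^ n i := by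
  have h := congrArg (descentHom W h₁ h₃ hroot hθ) hn
  have hP : ∀ i, descentHom W h₁ h₃ hroot hθ (P i) =
      Additive.ofMul (QuotientGroup.mk (u i)) := fun i => by
    have : u i = Units.mk0 (descentValue W θ (P i)) (descentValue_ne_zero hθ (P i)) :=
      Units.ext (hu i)
    rw [this]
    rfl
  simp only [map_sum, map_zsmul, hP, map_zero, ← ofMul_zpow, ← ofMul_prod,
    ← QuotientGroup.mk_zpow] at h
  have h' : ((∏ i, u i ^ n i : Kˣ) : Kˣ ⧸ (powMonoidHom 2 : Kˣ →* Kˣ).range) = 1 := by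
    rw [← QuotientGroup.mk'_apply, map_prod]
    exact h
  obtain ⟨v, hv⟩ := (QuotientGroup.eq_one_iff _).mp h'
  exact ⟨v, hv⟩

end Descent

/-! ### Residue symbols at p-adic roots -/

section Padic

variable {p : ℕ} [Fact p.Prime]

lemma PadicInt.exists_root_of_toZMod {f : ℤ[X]} {t : ℤ} (h0 : ((f.eval t : ℤ) : ZMod p) = 0)
    (h1 : ((f.derivative.eval t : ℤ) : ZMod p) ≠ 0) :
    ∃ z : ℤ_[p], f.aeval z = 0 ∧ PadicInt.toZMod z = (t : ZMod p) := by
  have hev : ∀ g : ℤ[X], g.aeval (t : ℤ_[p]) = ((g.eval t : ℤ) : ℤ_[p]) := fun g => by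
    simpa using aeval_algebraMap_apply ℤ_[p] t g
  have hd : ‖f.derivative.aeval (t : ℤ_[p])‖ = 1 := by
    rw [hev]
    refine le_antisymm (PadicInt.norm_le_one _) (not_lt.mp fun h => h1 ?_)
    rw [PadicInt.norm_int_lt_one_iff_dvd] at h
    exact (ZMod.intCast_zmod_eq_zero_iff_dvd _ _).mpr h
  have h0' : ‖f.aeval (t : ℤ_[p])‖ < 1 := by
    rw [hev, PadicInt.norm_int_lt_one_iff_dvd]
    exact (ZMod.intCast_zmod_eq_zero_iff_dvd _ _).mp h0
  obtain ⟨z, hz, hzt, -⟩ := hensels_lemma (F := f) (a := (t : ℤ_[p])) (by rw [hd]; simpa using h0')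
  refine ⟨z, hz, ?_⟩
  -- Hensel gives ‖z - t‖ < ‖f'(t)‖ = 1, that is z ≡ t modulo p.
  rw [hd, ← PadicInt.mem_nonunits, ← IsLocalRing.mem_maximalIdeal, ← PadicInt.ker_toZMod, RingHom.mem_ker,
    map_sub, sub_eq_zero] at hzt
  simpa using hzt

/-- A square root of an element of norm 1 has norm 1, so it is already a p-adic unit. -/
lemma PadicInt.exists_units_sq_eq (w : ℤ_[p]ˣ) (v : ℚ_[p]) (h : v ^ 2 = ((w : ℤ_[p]) : ℚ_[p])) :
    ∃ u : ℤ_[p]ˣ, u ^ 2 = w := by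
  have hw : ‖((w : ℤ_[p]) : ℚ_[p])‖ = 1 := by
    rw [← PadicInt.norm_def]
    exact PadicInt.isUnit_iff.mp w.isUnit
  have hv : ‖v‖ = 1 := by
    rw [← h, norm_pow] at hw
    exact (pow_eq_one_iff_of_nonneg (norm_nonneg _) two_ne_zero).mp hw
  exact ⟨PadicInt.mkUnits hv, Units.ext (Subtype.ext h)⟩

/-- The quadratic character of the residue field, on the `p`-adic units. -/
noncomputable def padicQuadraticChar (p : ℕ) [Fact p.Prime] : ℤ_[p]ˣ →* ℤˣ :=
  Units.map ((quadraticChar (ZMod p)).toMonoidHom.comp (PadicInt.toZMod (p := p)).toMonoidHom)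

/-- The relation between quadratic residue symbols of `x(Pᵢ) - t` forced by a relation between
points `Pᵢ` with integral `x`-coordinates, where `t` is a simple root of the cubic modulo `p`. -/
lemma prod_legendreSym_zpow_eq_one {ι : Type*} [Fintype ι] {W : WeierstrassCurve.Affine ℚ}
    (h₁ : W.a₁ = 0) (h₃ : W.a₃ = 0) {f : ℤ[X]}
    (hf : f.map (Int.castRingHom ℚ) = X ^ 3 + C W.a₂ * X ^ 2 + C W.a₄ * X + C W.a₆)
    (hirr : ∀ x : ℚ, f.aeval x ≠ 0) {t : ℤ} (h0 : ((f.eval t : ℤ) : ZMod p) = 0)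
    (h1 : ((f.derivative.eval t : ℤ) : ZMod p) ≠ 0)
    (a : ι → ℤ) (y : ι → ℚ) (hP : ∀ i, W.Nonsingular (a i) (y i)) (n : ι → ℤ)
    (hn : ∑ i, n i • Affine.Point.some _ _ (hP i) = 0) (s : ι → ℤˣ)
    (hs : ∀ i, legendreSym p (a i - t) = s i) : ∏ i, s i ^ n i = 1 := by
  obtain ⟨z, hz, hzt⟩ := PadicInt.exists_root_of_toZMod h0 h1
  have hzQ : f.aeval (z : ℚ_[p]) = 0 := by
    have := aeval_algebraMap_apply ℚ_[p] z f
    rw [hz, map_zero] at this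
    exact this
  have hroot : (z : ℚ_[p]) ^ 3 + algebraMap ℚ ℚ_[p] W.a₂ * (z : ℚ_[p]) ^ 2 +
      algebraMap ℚ ℚ_[p] W.a₄ * (z : ℚ_[p]) + algebraMap ℚ ℚ_[p] W.a₆ = 0 := by
    rw [← aeval_map_algebraMap ℚ, show algebraMap ℤ ℚ = Int.castRingHom ℚ from rfl, hf] at hzQ
    simpa using hzQ
  have hθ : ∀ x : ℚ, algebraMap ℚ ℚ_[p] x ≠ z := fun x hx => hirr x <| by
    rw [← hx, aeval_algebraMap_apply] at hzQ
    simpa using hzQ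
  have htoZMod : ∀ i, PadicInt.toZMod ((a i : ℤ_[p]) - z) = ((a i - t : ℤ) : ZMod p) := fun i => by
    simp [hzt]
  -- The symbols are signs, hence nonzero, so no x(Pᵢ) - z reduces to 0.
  have hunit : ∀ i, IsUnit ((a i : ℤ_[p]) - z) := fun i => by
    by_contra h
    have h' : (a i : ℤ_[p]) - z ∈ RingHom.ker (PadicInt.toZMod : ℤ_[p] →+* ZMod p) := by
      rw [PadicInt.ker_toZMod]
      exact h
    rw [RingHom.mem_ker, htoZMod, ← legendreSym.eq_zero_iff, hs] at h'
    exact (s i).ne_zero h'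
  choose u hu using hunit
  have hchar : ∀ i, padicQuadraticChar p (u i) = s i := fun i => by
    ext
    rw [← hs, padicQuadraticChar, Units.coe_map, hu]
    exact congrArg (quadraticChar (ZMod p)) (htoZMod i)
  obtain ⟨v, hv⟩ := exists_sq_eq_prod_of_sum_zsmul_eq_zero h₁ h₃ hroot hθ _ n hn
    (fun i => Units.map (PadicInt.Coe.ringHom (p := p)).toMonoidHom (u i)) (fun i => by
      rw [Units.coe_map, hu]
      simp [descentValue]
      rfl)
  simp only [← map_zpow, ← map_prod] at hv
  obtain ⟨r, hr⟩ := PadicInt.exists_units_sq_eq (∏ i, u i ^ n i) (v : ℚ_[p])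
    (congrArg Units.val hv)
  have := congrArg (padicQuadraticChar p) hr
  rw [map_pow, Int.units_sq, map_prod] at this
  simpa [hchar] using this.symm

end Padic

/-- Infinite descent: in a group without `2`-torsion, a family all of whose relations have even
coefficients is linearly independent. -/
lemma linearIndependent_int_of_forall_even {ι M : Type*} [Fintype ι] [AddCommGroup M]
    (htors : ∀ m : M, m + m = 0 → m = 0) (P : ι → M)
    (heven : ∀ n : ι → ℤ, ∑ i, n i • P i = 0 → ∀ i, Even (n i)) : LinearIndependent ℤ P := by
  rw [Fintype.linearIndependent_iff]
  have key : ∀ k : ℕ, ∀ n : ι → ℤ, ∑ i, n i • P i = 0 → ∀ i, (2 : ℤ) ^ k ∣ n i := by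
    intro k
    induction k with
    | zero => simp
    | succ k ih =>
      intro n hn i
      choose m hm using heven n hn
      have h := htors (∑ i, m i • P i) (by
        simpa only [← Finset.sum_add_distrib, ← add_smul, ← hm] using hn)
      obtain ⟨c, hc⟩ := ih m h i
      exact ⟨c, by rw [hm, hc]; ring⟩
  intro n hn i
  by_contra hi
  have h := Int.natAbs_dvd_natAbs.mpr (key (n i).natAbs n hn i)
  rw [Int.natAbs_pow] at h
  exact absurd (Nat.le_of_dvd (Int.natAbs_pos.mpr hi) h) (not_le.mpr Nat.lt_two_pow_self)

/-! ### The curve and its lack of 2-torsion -/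

/-- The cubic polynomial defining `rankSixCurve`. -/
noncomputable def rankSixCubic : ℤ[X] :=
  X ^ 3 + C 1123187040185717205972 * X + C 50786893859117937639786031372848

lemma rankSixCubic_eval (t : ℤ) : rankSixCubic.eval t =
    t ^ 3 + 1123187040185717205972 * t + 50786893859117937639786031372848 := by
  simp [rankSixCubic]

lemma rankSixCubic_derivative_eval (t : ℤ) : rankSixCubic.derivative.eval t =
    3 * t ^ 2 + 1123187040185717205972 := by
  simp [rankSixCubic, -eq_intCast]

lemma rankSixCubic_aeval (x : ℚ) : rankSixCubic.aeval x =
    x ^ 3 + 1123187040185717205972 * x + 50786893859117937639786031372848 := by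
  simp [rankSixCubic, -eq_intCast]

lemma rankSixCubic_map : rankSixCubic.map (Int.castRingHom ℚ) =
    X ^ 3 + C rankSixCurve.a₂ * X ^ 2 + C rankSixCurve.a₄ * X + C rankSixCurve.a₆ := by
  simp [rankSixCubic, rankSixCurve, -eq_intCast]

lemma rankSixCubic_monic : rankSixCubic.Monic := by
  unfold rankSixCubic
  monicity!

/-- The cubic has no root modulo `41`. -/
lemma rankSixCubic_aeval_ne_zero (x : ℚ) : rankSixCubic.aeval x ≠ 0 := by
  intro h
  obtain ⟨t, ht, -⟩ := exists_integer_of_is_root_of_monic rankSixCubic_monic h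
  rw [ht, aeval_algebraMap_apply, map_eq_zero_iff _ (algebraMap ℤ ℚ).injective_int] at h
  have h' := congrArg (Int.cast : ℤ → ZMod 41) h
  simp only [coe_aeval_eq_eval, rankSixCubic_eval] at h'
  push_cast at h'
  generalize (t : ZMod 41) = s at h'
  revert s
  decide

lemma rankSixCurve_nonsingular {x y : ℚ}
    (h : y ^ 2 = x ^ 3 + 1123187040185717205972 * x + 50786893859117937639786031372848) :
    rankSixCurve.Nonsingular x y := by
  have hy : y ≠ 0 := by
    rintro rfl
    refine rankSixCubic_aeval_ne_zero x ?_
    rw [rankSixCubic_aeval]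
    linarith
  rw [Affine.nonsingular_iff, Affine.equation_iff]
  refine ⟨by simpa [rankSixCurve] using h, Or.inr ?_⟩
  simp only [rankSixCurve]
  contrapose! hy
  linarith

lemma rankSixCurve_add_self_eq_zero (P : rankSixCurve.Point) (h : P + P = 0) : P = 0 := by
  rcases P with _ | ⟨x, y, n⟩
  · rfl
  exfalso
  by_cases hy : y = rankSixCurve.negY x y
  · have hy0 : y = 0 := by
      simp only [Affine.negY, rankSixCurve] at hy
      linarith
    have he := (Affine.equation_iff _ _).mp n.left
    refine rankSixCubic_aeval_ne_zero x ?_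
    simp only [rankSixCurve, hy0] at he
    rw [rankSixCubic_aeval]
    linarith
  · rw [Affine.Point.add_self_of_Y_ne hy] at h
    exact Affine.Point.some_ne_zero _ h

lemma pointX_pointY_nonsingular (i : Fin 6) : rankSixCurve.Nonsingular (pointX i) (pointY i) := by
  apply rankSixCurve_nonsingular
  fin_cases i <;> norm_num [pointX, pointY]

/-! ### Descent on the saturated family -/

/-- The `x`-coordinates of half the sum `P₀ + P₁ - P₂ + P₃ - P₄ - P₅` of the six given points, and
of `P₁, …, P₅`. -/
def saturatedX : Fin 6 → ℤ :=
  ![-5865550026, 60673071396, 49153071576, 33025071828, 12289072152, -13054927452]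

/-- The `y`-coordinates corresponding to `saturatedX`. -/
def saturatedY : Fin 6 → ℚ :=
  ![6633022066272000, 18500949214922664, 14991664661755236, 11131001682078096,
    8151425152633980, 5822267813027064]

lemma saturated_nonsingular (i : Fin 6) :
    rankSixCurve.Nonsingular (saturatedX i) (saturatedY i) := by
  apply rankSixCurve_nonsingular
  fin_cases i <;> norm_num [saturatedX, saturatedY]

lemma saturated_prod_eq_one {p : ℕ} [Fact p.Prime] {n : Fin 6 → ℤ}
    (hn : ∑ i, n i • Affine.Point.some _ _ (saturated_nonsingular i) = 0) (t : ℤ)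
    (h0 : (p : ℤ) ∣ t ^ 3 + 1123187040185717205972 * t + 50786893859117937639786031372848)
    (h1 : ¬ (p : ℤ) ∣ 3 * t ^ 2 + 1123187040185717205972) (s : Fin 6 → ℤˣ)
    (hs : ∀ i, legendreSym p (saturatedX i - t) = s i) : ∏ i, s i ^ n i = 1 :=
  prod_legendreSym_zpow_eq_one rfl rfl rankSixCubic_map rankSixCubic_aeval_ne_zero
    (by rwa [rankSixCubic_eval, ZMod.intCast_zmod_eq_zero_iff_dvd])
    (by rwa [rankSixCubic_derivative_eval, Ne, ZMod.intCast_zmod_eq_zero_iff_dvd]) _ _ _ n hn s hs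

lemma Int.even_of_neg_one_units_zpow_eq_one {n : ℤ} (h : (-1 : ℤˣ) ^ n = 1) : Even n := by
  by_contra hn
  rw [Int.not_even_iff_odd] at hn
  rw [hn.neg_one_zpow] at h
  exact absurd h (by decide)

/-- The 6 × 6 matrix over 𝔽₂ recording the signs at the six primes is invertible. -/
lemma saturated_even {n : Fin 6 → ℤ}
    (hn : ∑ i, n i • Affine.Point.some _ _ (saturated_nonsingular i) = 0) (i : Fin 6) :
    Even (n i) := by
  have : Fact (Nat.Prime 11) := ⟨by norm_num⟩
  have : Fact (Nat.Prime 13) := ⟨by norm_num⟩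
  have : Fact (Nat.Prime 17) := ⟨by norm_num⟩
  have : Fact (Nat.Prime 23) := ⟨by norm_num⟩
  have : Fact (Nat.Prime 31) := ⟨by norm_num⟩
  have : Fact (Nat.Prime 37) := ⟨by norm_num⟩
  have e₁ := saturated_prod_eq_one (p := 11) hn 9 (by norm_num) (by norm_num)
    ![-1, 1, -1, 1, -1, -1] (by intro i; fin_cases i <;> norm_num [saturatedX])
  have e₂ := saturated_prod_eq_one (p := 13) hn 7 (by norm_num) (by norm_num)
    ![-1, -1, 1, 1, 1, -1] (by intro i; fin_cases i <;> norm_num [saturatedX])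
  have e₃ := saturated_prod_eq_one (p := 17) hn 5 (by norm_num) (by norm_num)
    ![1, 1, 1, -1, 1, 1] (by intro i; fin_cases i <;> norm_num [saturatedX])
  have e₄ := saturated_prod_eq_one (p := 23) hn 7 (by norm_num) (by norm_num)
    ![1, -1, -1, -1, 1, -1] (by intro i; fin_cases i <;> norm_num [saturatedX])
  have e₅ := saturated_prod_eq_one (p := 31) hn 29 (by norm_num) (by norm_num)
    ![1, -1, 1, -1, -1, 1] (by intro i; fin_cases i <;> norm_num [saturatedX])
  have e₆ := saturated_prod_eq_one (p := 37) hn 8 (by norm_num) (by norm_num)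
    ![1, -1, 1, -1, 1, 1] (by intro i; fin_cases i <;> norm_num [saturatedX])
  simp only [Fin.prod_univ_six, Matrix.cons_val, one_zpow, one_mul, mul_one, ← zpow_add]
    at e₁ e₂ e₃ e₄ e₅ e₆
  replace e₁ := Int.even_of_neg_one_units_zpow_eq_one e₁
  replace e₂ := Int.even_of_neg_one_units_zpow_eq_one e₂
  replace e₃ := Int.even_of_neg_one_units_zpow_eq_one e₃
  replace e₄ := Int.even_of_neg_one_units_zpow_eq_one e₄
  replace e₅ := Int.even_of_neg_one_units_zpow_eq_one e₅
  replace e₆ := Int.even_of_neg_one_units_zpow_eq_one e₆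
  rw [Int.even_iff] at *
  fin_cases i <;> simp <;> omega

lemma saturated_linearIndependent :
    LinearIndependent ℤ fun i => Affine.Point.some _ _ (saturated_nonsingular i) :=
  linearIndependent_int_of_forall_even rankSixCurve_add_self_eq_zero _
    fun _ hn => saturated_even hn

/-! ### Return to the given points -/

lemma rankSixCurve_some_add_some {x₁ y₁ x₂ y₂ x₃ y₃ : ℚ} (h₁ : rankSixCurve.Nonsingular x₁ y₁)
    (h₂ : rankSixCurve.Nonsingular x₂ y₂) (h₃ : rankSixCurve.Nonsingular x₃ y₃) (ℓ : ℚ)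
    (hne : x₁ ≠ x₂) (hℓ : ℓ * (x₁ - x₂) = y₁ - y₂) (hx : ℓ ^ 2 - x₁ - x₂ = x₃)
    (hy : ℓ * (x₁ - x₃) - y₁ = y₃) :
    Affine.Point.some x₁ y₁ h₁ + Affine.Point.some x₂ y₂ h₂ = Affine.Point.some x₃ y₃ h₃ := by
  have hs : rankSixCurve.slope x₁ x₂ y₁ y₂ = ℓ := by
    rw [Affine.slope_of_X_ne hne, div_eq_iff (sub_ne_zero.mpr hne), hℓ]
  have hx' : rankSixCurve.addX x₁ x₂ ℓ = x₃ := by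
    simp only [Affine.addX, rankSixCurve]
    linear_combination hx
  have hy' : rankSixCurve.addY x₁ x₂ y₁ ℓ = y₃ := by
    simp only [Affine.addY, Affine.negAddY, Affine.negY, hx']
    simp only [rankSixCurve]
    linear_combination hy
  subst hs hx' hy'
  exact Affine.Point.add_of_X_ne hne

/-- Both sides are computed by chains of chords. -/
lemma sum_points_eq {P₀ P₁ P₂ P₃ P₄ P₅ Q : rankSixCurve.Point}
    {h₀ h₁ h₂ h₃ h₄ h₅ h}
    (e₀ : P₀ = .some 67585071288 20866449849961716 h₀)
    (e₁ : P₁ = .some 60673071396 18500949214922664 h₁)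
    (e₂ : P₂ = .some 49153071576 14991664661755236 h₂)
    (e₃ : P₃ = .some 33025071828 11131001682078096 h₃)
    (e₄ : P₄ = .some 12289072152 8151425152633980 h₄)
    (e₅ : P₅ = .some (-13054927452) 5822267813027064 h₅)
    (e : Q = .some (-5865550026) 6633022066272000 h) :
    P₀ + P₁ + P₃ = (Q + P₄) + ((Q + P₅) + P₂) := by
  subst e₀ e₁ e₂ e₃ e₄ e₅ e
  -- Adding Q in two separate chords avoids tangents; both sides end at the point with x-denominator
  -- 59².
  rw [rankSixCurve_some_add_some h₀ h₁ (x₃ := -11136085323) (y₃ := 6074370298177425)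
      (rankSixCurve_nonsingular (by norm_num)) 342231 (by norm_num) (by norm_num) (by norm_num)
      (by norm_num),
    rankSixCurve_some_add_some _ h₃ (x₃ := -30555552587784 / 3481)
      (y₃ := -1303007042686699060956 / 205379)
      (rankSixCurve_nonsingular (by norm_num)) (6755739 / 59) (by norm_num) (by norm_num)
      (by norm_num) (by norm_num),
    rankSixCurve_some_add_some h h₄ (x₃ := 69172222854 / 121)
      (y₃ := -9545151633165792000 / 1331)
      (rankSixCurve_nonsingular (by norm_num)) (920010 / 11) (by norm_num) (by norm_num)
      (by norm_num) (by norm_num),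
    rankSixCurve_some_add_some h h₅ (x₃ := 43312156958406 / 1369)
      (y₃ := -550209000823753824000 / 50653)
      (rankSixCurve_nonsingular (by norm_num)) (4172532 / 37) (by norm_num) (by norm_num)
      (by norm_num) (by norm_num),
    rankSixCurve_some_add_some _ h₂ (x₃ := 2098029745974) (y₃ := -3039303415961952000)
      (rankSixCurve_nonsingular (by norm_num)) (54615066 / 37) (by norm_num) (by norm_num)
      (by norm_num) (by norm_num),
    rankSixCurve_some_add_some _ _ (x₃ := -30555552587784 / 3481)
      (y₃ := -1303007042686699060956 / 205379)
      (rankSixCurve_nonsingular (by norm_num)) (-938208822 / 649) (by norm_num) (by norm_num)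
      (by norm_num) (by norm_num)]

lemma linearIndependent_int_of_add_eq {M : Type*} [AddCommGroup M] {P S : Fin 6 → M}
    (hS : LinearIndependent ℤ S) (s₁ : S 1 = P 1) (s₂ : S 2 = P 2) (s₃ : S 3 = P 3)
    (s₄ : S 4 = P 4) (s₅ : S 5 = P 5)
    (hsum : P 0 + P 1 + P 3 = (S 0 + P 4) + ((S 0 + P 5) + P 2)) : LinearIndependent ℤ P := by
  rw [Fintype.linearIndependent_iff] at hS ⊢
  intro n hn
  have hP₀ : P 0 = (2 : ℤ) • S 0 - P 1 + P 2 - P 3 + P 4 + P 5 := by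
    rw [← sub_eq_zero] at hsum ⊢
    rw [← hsum]
    module
  -- These are the coefficients after substituting `hP₀`; their vanishing gives n₀ = 0, then the
  -- rest.
  have h := hS ![2 * n 0, n 1 - n 0, n 2 + n 0, n 3 - n 0, n 4 + n 0, n 5 + n 0] (by
    rw [Fin.sum_univ_six] at hn ⊢
    simp only [Matrix.cons_val, s₁, s₂, s₃, s₄, s₅]
    rw [← hn, hP₀]
    module)
  have h0 := h 0
  have h1 := h 1
  have h2 := h 2
  have h3 := h 3
  have h4 := h 4
  have h5 := h 5
  simp only [Matrix.cons_val] at h0 h1 h2 h3 h4 h5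
  intro i
  fin_cases i <;> simp <;> omega

lemma points_linearIndependent : LinearIndependent ℤ
    fun i => Affine.Point.some (pointX i) (pointY i) (pointX_pointY_nonsingular i) := by
  refine linearIndependent_int_of_add_eq saturated_linearIndependent ?_ ?_ ?_ ?_ ?_
    (sum_points_eq (h := rankSixCurve_nonsingular (by norm_num)) rfl rfl rfl rfl rfl rfl ?_)
  all_goals simp [saturatedX, saturatedY, pointX, pointY]

theorem mainTheorem2 :
    -- the curve is an elliptic curve over `ℚ`
    rankSixCurve.IsElliptic ∧
    -- its Mordell-Weil group has rank at least six
    6 ≤ Module.rank ℤ rankSixCurve.Point ∧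
    -- the six explicit pairs are points of the curve, and these points are independent
    ∃ h : ∀ i : Fin 6, rankSixCurve.Nonsingular (pointX i) (pointY i),
      LinearIndependent ℤ
        (fun i : Fin 6 => WeierstrassCurve.Affine.Point.some (pointX i) (pointY i) (h i)) := by
  refine ⟨⟨?_⟩, ?_, pointX_pointY_nonsingular, points_linearIndependent⟩
  · rw [isUnit_iff_ne_zero]
    norm_num [rankSixCurve, WeierstrassCurve.Δ, WeierstrassCurve.b₂, WeierstrassCurve.b₄,
      WeierstrassCurve.b₆, WeierstrassCurve.b₈]
  · simpa using points_linearIndependent.cardinal_le_rank
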